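/- Let $\mathcal A$ be an abelian length category, i.e. an abelian category in which every object has a composition series. All subcategories are full, closed under isomorphisms, and contain the zero object. Let $\operatorname{wide}\mathcal A$ be the set of wide subcategories of $\mathcal A$ (closed under extensions, kernels and cokernels) and $\operatorname{tors}\mathcal A$ the set of torsion classes (closed under extensions and quotients), both ordered by inclusion, and for a subcategory $\mathcal C$ let $T(\mathcal C)$ be the smallest torsion class containing $\mathcal C$. A complete lattice $L$ is completely semidistributive if for all $a,b\in L$ and all non-empty $X\subseteq L$: if $a\vee x=b$ for all $x\in X$ then $a\vee\bigwedge X=b$, and if $a\wedge x=b$ for all $x\in X$ then $a\wedge\bigvee X=b$. In such an $L$, for a completely join-irreducible $j$ (that is, $j=\bigvee X$ implies $j\in X$) put $j_*=\bigvee\{x\in L\mid x<j\}$ and $\kappa(j)=\max\{x\in L\mid j\wedge x=j_*\}$. An expression $x=\bigvee S$ is a canonical join representation of $x\in L$ if $S\subseteq L$ is an antichain and, whenever $x=\bigvee B$ with $B\subseteq L$, every $a\in S$ satisfies $a\le b$ for some $b\in B$; such an $S$ is unique if it exists, and it consists of completely join-irreducible elements. Let $L_0$ be the set of elements with a canonical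 join representation; for $x\in L_0$ with canonical join representation $x=\bigvee S$ put $\bar\kappa(x)=\bigwedge\{\kappa(j)\mid j\in S\}$. Let $L_\kappa$ be the set $L_0$ with the partial order $$x\le_\kappa y\iff x\le y\text{ and }\bar\kappa(x)\ge\bar\kappa(y)\text{ in }L.$$ Then $\operatorname{tors}\mathcal A$ is a completely semidistributive lattice, and the map $\mathcal W\mapsto T(\mathcal W)$ is an isomorphism of posets from $\operatorname{wide}\mathcal A$ onto $(\operatorname{tors}\mathcal A)_\kappa$. -/

import Mathlib

open CategoryTheory CategoryTheory.Limits

universe v u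

noncomputable section

namespace KappaOrder

section Lattice

variable {L : Type u} [CompleteLattice L]

/-- `j` is completely join-irreducible: `j = ⋁ X` implies `j ∈ X`.
(With `X = ∅` this excludes the least element.) -/
def IsCompletelyJoinIrreducible (j : L) : Prop :=
  ∀ X : Set L, j = sSup X → j ∈ X

/-- `a_*`, the join of all elements strictly below `a`. -/
def lowerStar (a : L) : L := sSup {x | x < a}

variable (L) in
/-- Complete semidistributivity of a complete lattice. -/
structure IsCompletelySemidistributive : Prop where
  sup_sInf : ∀ (a b : L) (X : Set L), X.Nonempty → (∀ x ∈ X, a ⊔ x = b) → a ⊔ sInf X = b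
  inf_sSup : ∀ (a b : L) (X : Set L), X.Nonempty → (∀ x ∈ X, a ⊓ x = b) → a ⊓ sSup X = b

/-- The kappa map. On a completely join-irreducible element `j` of a completely semidistributive
lattice this is `max {x | j ⊓ x = j_*}`, see `isGreatest_kappa`. -/
def kappa (j : L) : L := sSup {x | j ⊓ x = lowerStar j}

theorem isGreatest_kappa (hL : IsCompletelySemidistributive L) (j : L) :
    IsGreatest {x | j ⊓ x = lowerStar j} (kappa j) := by
  have hmem : lowerStar j ∈ {x | j ⊓ x = lowerStar j} :=
    inf_eq_right.2 (sSup_le fun x hx => le_of_lt hx)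
  exact ⟨hL.inf_sSup j _ _ ⟨_, hmem⟩ fun x hx => hx, fun x hx => le_sSup hx⟩

/-- `x = ⋁ S` is a canonical join representation of `x`. -/
structure IsCanonicalJoinRep (x : L) (S : Set L) : Prop where
  eq_sSup : x = sSup S
  refines : ∀ B : Set L, x = sSup B → ∀ a ∈ S, ∃ b ∈ B, a ≤ b
  antichain : ∀ a ∈ S, ∀ b ∈ S, a ≤ b → a = b

theorem IsCanonicalJoinRep.unique {x : L} {S S' : Set L}
    (h : IsCanonicalJoinRep x S) (h' : IsCanonicalJoinRep x S') : S = S' := by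
  have key : ∀ {S S' : Set L}, IsCanonicalJoinRep x S → IsCanonicalJoinRep x S' → S ⊆ S' := by
    intro S S' h h' a ha
    obtain ⟨b, hb, hab⟩ := h.refines S' h'.eq_sSup a ha
    obtain ⟨c, hc, hbc⟩ := h'.refines S h.eq_sSup b hb
    have hac := h.antichain a ha c hc (hab.trans hbc)
    have : a = b := le_antisymm hab (hac ▸ hbc)
    exact this ▸ hb
  exact Set.Subset.antisymm (key h h') (key h' h)

theorem IsCanonicalJoinRep.isCompletelyJoinIrreducible {x : L} {S : Set L}
    (h : IsCanonicalJoinRep x S) {a : L} (ha : a ∈ S) : IsCompletelyJoinIrreducible a := by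
  intro X hX
  have hx : x = sSup (X ∪ (S \ {a})) := by
    rw [sSup_union, ← hX, ← sSup_insert, Set.insert_sdiff_singleton, Set.insert_eq_of_mem ha]
    exact h.eq_sSup
  obtain ⟨b, hb | hb, hab⟩ := h.refines _ hx a ha
  · have : a = b := le_antisymm hab (hX ▸ le_sSup hb)
    exact this ▸ hb
  · exact absurd (h.antichain a ha b hb.1 hab).symm hb.2

variable (L) in
/-- The elements of `L` which have a canonical join representation, to be ordered by the
kappa order (this is a structure, so it does not inherit the order of `L`). -/
@[ext]
structure KappaPoset where
  val : L
  hasCJR : ∃ S : Set L, IsCanonicalJoinRep val S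

namespace KappaPoset

/-- The canonical join representation of `x`. -/
def CJR (x : KappaPoset L) : Set L := x.hasCJR.choose

theorem isCanonicalJoinRep_CJR (x : KappaPoset L) : IsCanonicalJoinRep x.val x.CJR :=
  x.hasCJR.choose_spec

/-- The extended kappa map. -/
def extKappa (x : KappaPoset L) : L := sInf (kappa '' x.CJR)

/-- The kappa order: `x ≤ y` and `extKappa x ≥ extKappa y` in `L`. -/
instance : PartialOrder (KappaPoset L) where
  le x y := x.val ≤ y.val ∧ extKappa x ≥ extKappa y
  le_refl x := ⟨le_rfl, le_rfl⟩
  le_trans x y z h h' := ⟨h.1.trans h'.1, h'.2.trans h.2⟩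
  le_antisymm x y h h' := KappaPoset.ext (le_antisymm h.1 h'.1)

end KappaPoset

end Lattice

section Category

variable {A : Type u} [Category.{v} A] [Abelian A]

/-- `X` has a composition series: a finite chain `0 = F 0 ≤ F 1 ≤ ⋯ ≤ F n = X` of subobjects
with simple subquotients (the values of `F` beyond `n` are then all equal to `X`). -/
def HasCompositionSeries (X : A) : Prop :=
  ∃ (n : ℕ) (F : ℕ → Subobject X) (hF : Monotone F), F 0 = ⊥ ∧ F n = ⊤ ∧
    ∀ i < n, Simple (cokernel (Subobject.ofLE (F i) (F (i + 1)) (hF (Nat.le_succ i))))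

variable (A) in
/-- An abelian length category: every object has a composition series. -/
class IsLengthCategory : Prop where
  hasCompositionSeries : ∀ X : A, HasCompositionSeries X

/-- A full subcategory, given by its objects, is a torsion class: it contains zero and is closed
under quotients and extensions. Closure under isomorphisms follows from that under quotients. -/
structure IsTorsionClass (P : ObjectProperty A) : Prop where
  containsZero : P.ContainsZero
  quotients : P.IsClosedUnderQuotients
  extensions : P.IsClosedUnderExtensions

/-- A full subcategory, given by its objects, is wide: it is closed under isomorphisms,
contains zero, and is closed under extensions, kernels and cokernels. -/
structure IsWideSubcategory (P : ObjectProperty A) : Prop where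
  isos : P.IsClosedUnderIsomorphisms
  containsZero : P.ContainsZero
  extensions : P.IsClosedUnderExtensions
  kernels : P.IsClosedUnderKernels
  cokernels : P.IsClosedUnderCokernels

variable (A) in
/-- The poset of wide subcategories, ordered by inclusion. -/
abbrev WideSubcategory : Type u := {P : ObjectProperty A // IsWideSubcategory P}

variable (A) in
/-- The torsion classes, ordered by inclusion. -/
abbrev TorsionClass : Type u := {P : ObjectProperty A // IsTorsionClass P}

namespace TorsionClass

/-- The intersection of a set of torsion classes. -/
instance : InfSet (TorsionClass A) where
  sInf s := ⟨fun X => ∀ T ∈ s, T.1 X,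
    { containsZero := ⟨⟨_, isZero_zero A, fun T _ => by
        have := T.2.containsZero
        have := T.2.quotients
        exact T.1.prop_zero⟩⟩
      quotients := ⟨fun f _ hX T hT => T.2.quotients.prop_of_epi f (hX T hT)⟩
      extensions := ⟨fun hS h₁ h₃ T hT =>
        T.2.extensions.prop_X₂_of_shortExact hS (h₁ T hT) (h₃ T hT)⟩ }⟩

/-- The complete lattice of torsion classes; meets are intersections. -/
instance : CompleteLattice (TorsionClass A) :=
  completeLatticeOfInf (TorsionClass A) fun _ =>
    ⟨fun T hT _ hX => hX T hT, fun _ hU X hX T hT => hU hT X hX⟩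

end TorsionClass

/-- `T(C)`, the smallest torsion class containing `C`. -/
def torsionClosure (P : ObjectProperty A) : TorsionClass A :=
  sInf {T : TorsionClass A | P ≤ T.1}

end Category

end KappaOrder

end

/-
If `T ≰ T'`, an object of `T` outside `T'` all of whose proper quotients lie in `T'` receives no
nonzero morphism from `T'`. Such objects detect inclusions of torsion classes, which gives the meet
half of complete semidistributivity; the join half is the same argument with proper subobjects of
torsion-free objects. Applied to `j_* < j`, it also shows that the completely join-irreducible
torsion classes are of the form `T(B)` for bricks `B`, and one finds `κ(T(B)) = ⊥B`.

If `C` is closed under kernels and cokernels, the objects all of whose morphisms `f` to objects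
of `C` satisfy `coker f ∈ C` and `ker f ∈ T(C)` form a torsion class containing `C`, hence
containing `T(C)`. So nonzero morphisms from `T(C)` to a simple object of `C` are epimorphisms, and
`T(C)` has the canonical join representation `⋁ T(B)`, with `B` running through the simple objects
of `C`. For wide `W` it follows that `κ̄(T(W)) = ⊥W`, and `W` is recovered from `T(W)` and `⊥W` as
the objects of `T(W)` receiving no nonzero morphism from `⊥W`.

Conversely, let `T(B)` be a term of the canonical join representation of a torsion class `T`. Then
`T` is the join of `T(B)` and a torsion class orthogonal to `B`, so the kernel of every morphism
from an object of `T` to `B` lies in `T`. The objects of `T` with this property form a wide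
subcategory, which therefore generates `T`.
-/

noncomputable section

namespace KappaOrder

section Extensions

variable {A : Type u} [Category.{v} A] [Abelian A] (P : ObjectProperty A)
  [P.IsClosedUnderExtensions] {X Y : A}

theorem prop_of_mono_of_prop_cokernel (i : X ⟶ Y) [Mono i] (hX : P X) (hC : P (cokernel i)) :
    P Y :=
  P.prop_X₂_of_shortExact (S := ShortComplex.mk i (cokernel.π i) (cokernel.condition i))
    { exact := ShortComplex.exact_cokernel i } hX hC

theorem prop_of_epi_of_prop_kernel (p : X ⟶ Y) [Epi p] (hK : P (kernel p)) (hY : P Y) : P X :=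
  P.prop_X₂_of_shortExact (S := ShortComplex.mk (kernel.ι p) p (kernel.condition p))
    { exact := ShortComplex.exact_kernel p } hK hY

end Extensions

section Length

section Subobjects

variable {C : Type u} [Category.{v} C] [∀ X : C, IsArtinianObject X]

/- Inducting on the subobjects of a fixed object avoids transporting `P` along isomorphisms. -/
@[elab_as_elim]
theorem subobject_induction {P : C → Prop} (X : C)
    (h : ∀ X, (∀ ⦃Y : C⦄ (i : Y ⟶ X) [Mono i], ¬ IsIso i → P Y) → P X) : P X := by
  suffices ∀ (S : Subobject X) ⦃Y : C⦄ (i : Y ⟶ X) [Mono i], Subobject.mk i = S → P Y from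
    this _ (𝟙 X) rfl
  intro S
  induction S using WellFoundedLT.induction with
  | ind S ih =>
    rintro Y i _ rfl
    exact h Y fun Z j _ hj => ih _ (Subobject.mk_lt_mk_of_comm j rfl hj) (j ≫ i) rfl

theorem isIso_of_mono_endomorphism {X : C} (f : X ⟶ X) [Mono f] : IsIso f := by
  induction X using subobject_induction with
  | h X ih => exact by_contra fun hf => hf (ih f hf f)

end Subobjects

variable {A : Type u} [Category.{v} A] [Abelian A]

theorem kernelSubobject_lt_kernelSubobject_comp {X Y Z : A} (p : X ⟶ Y) [Epi p] (q : Y ⟶ Z)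
    (hq : ¬ Mono q) : kernelSubobject p < kernelSubobject (p ≫ q) := by
  refine lt_of_le_not_ge (kernelSubobject_comp_le p q) fun hle => hq ?_
  refine Preadditive.mono_of_cancel_zero _ fun t ht => ?_
  obtain ⟨B, π, _, x, hx⟩ := surjective_up_to_refinements_of_epi p t
  have hxq : (kernelSubobject (p ≫ q)).Factors x :=
    kernelSubobject_factors _ _ (by rw [← reassoc_of% hx, ht, comp_zero])
  rw [← cancel_epi π, hx, comp_zero]
  exact (kernelSubobject_factors_iff p x).1 (Subobject.factors_of_le x hle hxq)

@[elab_as_elim]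
theorem quotient_induction [∀ X : A, IsNoetherianObject X] {P : A → Prop} (X : A)
    (h : ∀ X, (∀ ⦃Y : A⦄ (p : X ⟶ Y) [Epi p], ¬ IsIso p → P Y) → P X) : P X := by
  suffices ∀ (S : Subobject X) ⦃Y : A⦄ (p : X ⟶ Y) [Epi p], kernelSubobject p = S → P Y from
    this _ (𝟙 X) rfl
  intro S
  induction S using WellFoundedGT.induction with
  | ind S ih =>
    rintro Y p _ rfl
    exact h Y fun Z q _ hq => ih _ (kernelSubobject_lt_kernelSubobject_comp p q
      fun _ => hq (isIso_of_mono_of_epi q)) (p ≫ q) rfl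

theorem le_of_pullback_le_of_imageSubobject_le {S : ShortComplex A} (hS : S.Exact)
    {U V : Subobject S.X₂} (hUV : U ≤ V)
    (h₁ : (Subobject.pullback S.f).obj V ≤ (Subobject.pullback S.f).obj U)
    (h₃ : imageSubobject (V.arrow ≫ S.g) ≤ imageSubobject (U.arrow ≫ S.g)) : V ≤ U := by
  suffices Epi (U.ofLE V hUV) by
    have := isIso_of_mono_of_epi (U.ofLE V hUV)
    exact Subobject.le_of_comm (inv (U.ofLE V hUV)) (by simp)
  rw [epi_iff_surjective_up_to_refinements]
  intro B y
  obtain ⟨B', π, _, u, hu⟩ := surjective_up_to_refinements_of_epi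
    (factorThruImageSubobject (U.arrow ≫ S.g))
    (y ≫ factorThruImageSubobject (V.arrow ≫ S.g) ≫ Subobject.ofLE _ _ h₃)
  replace hu : π ≫ y ≫ V.arrow ≫ S.g = u ≫ U.arrow ≫ S.g := by
    simpa using hu =≫ (imageSubobject (U.arrow ≫ S.g)).arrow
  obtain ⟨B'', π', _, t, ht⟩ := hS.exact_up_to_refinements (π ≫ y ≫ V.arrow - u ≫ U.arrow)
    (by simp [hu])
  have hVt : V.Factors (t ≫ S.f) := by
    have := Subobject.factors_comp_arrow (π' ≫ (π ≫ y - u ≫ U.ofLE V hUV))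
    simpa [← ht] using this
  have hUt : U.Factors (t ≫ S.f) := (pullback_factors_iff _ _ _).1
    (Subobject.factors_of_le t h₁ (pullback_factors _ _ _ hVt))
  refine ⟨B'', π' ≫ π, inferInstance, π' ≫ u + U.factorThru _ hUt, ?_⟩
  rw [← cancel_mono V.arrow]
  simp [← ht]

variable {S : ShortComplex A}

theorem strictMono_pullback_imageSubobject (hS : S.Exact) :
    StrictMono fun U : Subobject S.X₂ =>
      ((Subobject.pullback S.f).obj U, imageSubobject (U.arrow ≫ S.g)) := by
  have hmono : Monotone fun U : Subobject S.X₂ =>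
      ((Subobject.pullback S.f).obj U, imageSubobject (U.arrow ≫ S.g)) := fun U V hUV =>
    ⟨(Subobject.pullback S.f).monotone hUV, by
      simpa using imageSubobject_comp_le (U.ofLE V hUV) (V.arrow ≫ S.g)⟩
  exact fun U V hUV => (hmono hUV.le).lt_of_not_ge fun h =>
    hUV.not_ge (le_of_pullback_le_of_imageSubobject_le hS hUV.le h.1 h.2)

instance isClosedUnderExtensions_isArtinianObject :
    (isArtinianObject (C := A)).IsClosedUnderExtensions where
  prop_X₂_of_shortExact hS (_ : WellFoundedLT _) (_ : WellFoundedLT _) :=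
    (strictMono_pullback_imageSubobject hS.exact).wellFoundedLT

instance isClosedUnderExtensions_isNoetherianObject :
    (isNoetherianObject (C := A)).IsClosedUnderExtensions where
  prop_X₂_of_shortExact hS (_ : WellFoundedGT _) (_ : WellFoundedGT _) :=
    (strictMono_pullback_imageSubobject hS.exact).wellFoundedGT

theorem HasCompositionSeries.prop {P : ObjectProperty A} [P.IsClosedUnderIsomorphisms]
    [P.ContainsZero] [P.IsClosedUnderExtensions] (hP : ∀ S, Simple S → P S) {X : A}
    (hX : HasCompositionSeries X) : P X := by
  obtain ⟨n, F, hF, h0, hn, hs⟩ := hX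
  suffices ∀ k ≤ n, P (F k : A) from
    P.prop_of_iso (asIso (⊤ : Subobject X).arrow) (hn ▸ this n le_rfl)
  intro k hk
  induction k with
  | zero => exact h0 ▸ P.prop_of_isZero ((isZero_zero A).of_iso Subobject.botCoeIsoZero)
  | succ k ih =>
    exact prop_of_mono_of_prop_cokernel P (Subobject.ofLE _ _ (hF (Nat.le_succ k)))
      (ih (Nat.le_of_succ_le hk)) (hP _ (hs k hk))

open scoped IsSimpleOrder in
theorem finite_subobject_of_simple (S : A) [Simple S] : Finite (Subobject S) :=
  have := (simple_iff_subobject_isSimpleOrder S).1 inferInstance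
  inferInstance

instance [IsLengthCategory A] (X : A) : IsArtinianObject X where
  prop := (IsLengthCategory.hasCompositionSeries X).prop (P := isArtinianObject) fun S _ =>
    have := finite_subobject_of_simple S
    Finite.to_wellFoundedLT

instance [IsLengthCategory A] (X : A) : IsNoetherianObject X where
  prop := (IsLengthCategory.hasCompositionSeries X).prop (P := isNoetherianObject) fun S _ =>
    have := finite_subobject_of_simple S
    Finite.to_wellFoundedGT

end Length

section CanonicalJoinRep

variable {L : Type u} [CompleteLattice L]

theorem lowerStar_le (a : L) : lowerStar a ≤ a := sSup_le fun _ hx => le_of_lt hx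

theorem IsCompletelyJoinIrreducible.lowerStar_lt {j : L} (hj : IsCompletelyJoinIrreducible j) :
    lowerStar j < j :=
  (lowerStar_le j).lt_of_ne fun h => lt_irrefl j (hj {x | x < j} h.symm)

variable {x j : L} {S : Set L}

theorem IsCanonicalJoinRep.sup_sSup_diff_singleton (h : IsCanonicalJoinRep x S) (hj : j ∈ S) :
    j ⊔ sSup (S \ {j}) = x := by
  rw [← sSup_insert, Set.insert_sdiff_singleton, Set.insert_eq_of_mem hj, h.eq_sSup]

theorem IsCanonicalJoinRep.not_le_lowerStar_sup (h : IsCanonicalJoinRep x S) (hj : j ∈ S) :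
    ¬ j ≤ lowerStar j ⊔ sSup (S \ {j}) := fun hle => by
  have hx : x = sSup (insert (lowerStar j) (S \ {j})) := by
    rw [sSup_insert, ← h.sup_sSup_diff_singleton hj]
    exact le_antisymm (sup_le hle le_sup_right) (sup_le_sup_right (lowerStar_le j) _)
  obtain ⟨b, rfl | hb, hjb⟩ := h.refines _ hx j hj
  · exact (h.isCompletelyJoinIrreducible hj).lowerStar_lt.not_ge hjb
  · exact hb.2 (h.antichain j hj b hb.1 hjb).symm

end CanonicalJoinRep

section TorsionPairs

variable {A : Type u} [Category.{v} A] [Abelian A]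

section Orthogonal

variable (P : ObjectProperty A)

instance : P.leftOrthogonal.IsClosedUnderQuotients where
  prop_of_epi p _ hX _ f hf := by rw [← cancel_epi p, hX (p ≫ f) hf, comp_zero]

instance : P.leftOrthogonal.IsClosedUnderExtensions where
  prop_X₂_of_shortExact {S} hS h₁ h₃ M f hM := by
    have := hS.epi_g
    have hf : S.f ≫ f = 0 := h₁ _ hM
    rw [← hS.exact.g_desc f hf, h₃ (hS.exact.desc f hf) hM, comp_zero]

instance : P.rightOrthogonal.IsClosedUnderSubobjects where
  prop_of_mono i _ hY _ f hf := by rw [← cancel_mono i, hY (f ≫ i) hf, zero_comp]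

instance : P.rightOrthogonal.IsClosedUnderExtensions where
  prop_X₂_of_shortExact {S} hS h₁ h₃ M f hM := by
    have := hS.mono_f
    have hf : f ≫ S.g = 0 := h₃ _ hM
    rw [← hS.exact.lift_f f hf, h₁ (hS.exact.lift f hf) hM, zero_comp]

variable {P} {X : A}

theorem isZero_of_leftOrthogonal (h : P.leftOrthogonal X) (hX : P X) : IsZero X :=
  (IsZero.iff_id_eq_zero X).2 (h _ hX)

theorem isZero_of_rightOrthogonal (h : P.rightOrthogonal X) (hX : P X) : IsZero X :=
  (IsZero.iff_id_eq_zero X).2 (h _ hX)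

theorem exists_ne_zero_of_not_leftOrthogonal (h : ¬ P.leftOrthogonal X) :
    ∃ (Y : A) (f : X ⟶ Y), P Y ∧ f ≠ 0 := by
  simpa only [ObjectProperty.leftOrthogonal_iff, not_forall, exists_prop] using h

theorem exists_ne_zero_of_not_rightOrthogonal (h : ¬ P.rightOrthogonal X) :
    ∃ (Y : A) (f : Y ⟶ X), P Y ∧ f ≠ 0 := by
  simpa only [ObjectProperty.rightOrthogonal_iff, not_forall, exists_prop] using h

end Orthogonal

section Image

variable {X Y : A} {f : X ⟶ Y}

theorem image_ι_ne_zero (hf : f ≠ 0) : Abelian.image.ι f ≠ 0 := fun h =>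
  hf (by rw [← Abelian.image.fac f, h, comp_zero])

theorem factorThruImage_ne_zero (hf : f ≠ 0) : Abelian.factorThruImage f ≠ 0 := fun h =>
  hf (by rw [← Abelian.image.fac f, h, zero_comp])

theorem epi_of_isIso_image_ι (f : X ⟶ Y) [IsIso (Abelian.image.ι f)] : Epi f :=
  Abelian.image.fac f ▸ inferInstance

theorem mono_of_isIso_factorThruImage (f : X ⟶ Y) [IsIso (Abelian.factorThruImage f)] : Mono f :=
  Abelian.image.fac f ▸ inferInstance

theorem not_isIso_cokernel_π (hf : f ≠ 0) : ¬ IsIso (cokernel.π f) := fun _ =>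
  hf (by rw [← cancel_mono (cokernel.π f), cokernel.condition, zero_comp])

theorem not_isIso_kernel_ι (hf : f ≠ 0) : ¬ IsIso (kernel.ι f) := fun _ =>
  hf (by rw [← cancel_epi (kernel.ι f), kernel.condition, comp_zero])

end Image

namespace TorsionClass

section

variable (T : TorsionClass A)

instance : T.1.ContainsZero := T.2.containsZero
instance : T.1.IsClosedUnderQuotients := T.2.quotients
instance : T.1.IsClosedUnderExtensions := T.2.extensions

end

theorem inf_prop_iff {T T' : TorsionClass A} {X : A} : (T ⊓ T').1 X ↔ T.1 X ∧ T'.1 X :=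
  ⟨fun h => ⟨inf_le_left (a := T) X h, inf_le_right (a := T) X h⟩,
    fun h => by rintro U (rfl | rfl); exacts [h.1, h.2]⟩

/-- The torsion class `⊥P` of the objects without nonzero morphisms to objects of `P`. -/
def leftPerp (P : ObjectProperty A) : TorsionClass A :=
  ⟨P.leftOrthogonal, inferInstance, inferInstance, inferInstance⟩

theorem leftPerp_antitone : Antitone (leftPerp (A := A)) :=
  fun _ _ h _ hX _ f hY => hX f (h _ hY)

theorem leftPerp_singleton_prop_iff {B X : A} :
    (leftPerp (.singleton B)).1 X ↔ ∀ f : X ⟶ B, f = 0 :=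
  ⟨fun h f => h f (by simp), fun h _ f hY => by
    obtain rfl := (ObjectProperty.singleton_iff _ _).1 hY
    exact h f⟩

theorem le_leftPerp_iff {T : TorsionClass A} {P : ObjectProperty A} :
    T ≤ leftPerp P ↔ P ≤ T.1.rightOrthogonal :=
  ⟨fun h _ hY _ f hX => h _ hX f hY, fun h _ hX _ f hY => h _ hY f hX⟩

theorem le_leftPerp_singleton_iff {T : TorsionClass A} {M : A} :
    T ≤ leftPerp (.singleton M) ↔ T.1.rightOrthogonal M := by
  rw [le_leftPerp_iff, ObjectProperty.singleton_le_iff]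

theorem rightOrthogonal_of_le {T T' : TorsionClass A} (h : T ≤ T') {M : A}
    (hM : T'.1.rightOrthogonal M) : T.1.rightOrthogonal M := fun _ f hX => hM f (h _ hX)

theorem rightOrthogonal_sSup_iff {s : Set (TorsionClass A)} {M : A} :
    (sSup s).1.rightOrthogonal M ↔ ∀ T ∈ s, T.1.rightOrthogonal M := by
  simp only [← le_leftPerp_singleton_iff, sSup_le_iff]

theorem rightOrthogonal_sup_iff {T T' : TorsionClass A} {M : A} :
    (T ⊔ T').1.rightOrthogonal M ↔ T.1.rightOrthogonal M ∧ T'.1.rightOrthogonal M := by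
  simp only [← le_leftPerp_singleton_iff, sup_le_iff]

variable {T T' U : TorsionClass A} {M : A}

theorem prop_or_rightOrthogonal_of_quotients
    (h : ∀ ⦃Z : A⦄ (p : M ⟶ Z) [Epi p], ¬ IsIso p → T.1 Z) :
    T.1 M ∨ T.1.rightOrthogonal M := by
  refine or_iff_not_imp_right.2 fun hM => ?_
  obtain ⟨Y, f, hY, hf⟩ := exists_ne_zero_of_not_rightOrthogonal hM
  exact prop_of_mono_of_prop_cokernel T.1 (Abelian.image.ι f)
    (T.1.prop_of_epi (Abelian.factorThruImage f) hY)
    (h (cokernel.π (Abelian.image.ι f)) (not_isIso_cokernel_π (image_ι_ne_zero hf)))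

theorem prop_or_rightOrthogonal_of_subobjects
    (h : ∀ ⦃Y : A⦄ (i : Y ⟶ M) [Mono i], ¬ IsIso i → T.1.rightOrthogonal Y) :
    T.1 M ∨ T.1.rightOrthogonal M := by
  refine or_iff_not_imp_right.2 fun hM => ?_
  obtain ⟨Y, f, hY, hf⟩ := exists_ne_zero_of_not_rightOrthogonal hM
  have hfree := mt (h (Abelian.image.ι f)) fun hfree =>
    factorThruImage_ne_zero hf (hfree (Abelian.factorThruImage f) hY)
  have := not_not.1 hfree
  have := epi_of_isIso_image_ι f
  exact T.1.prop_of_epi f hY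

section Noetherian

variable [∀ X : A, IsNoetherianObject X]

theorem exists_rightOrthogonal_of_not_le (h : ¬ T ≤ T') :
    ∃ M, T.1 M ∧ ¬ T'.1 M ∧ T'.1.rightOrthogonal M ∧
      ∀ ⦃Z : A⦄ (p : M ⟶ Z) [Epi p], ¬ IsIso p → T'.1 Z := by
  contrapose! h
  intro M hM
  induction M using quotient_induction with
  | h M ih =>
    by_contra hM'
    have hquot : ∀ ⦃Z : A⦄ (p : M ⟶ Z) [Epi p], ¬ IsIso p → T'.1 Z :=
      fun Z p _ hp => ih p hp (T.1.prop_of_epi p hM)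
    obtain ⟨Z, p, _, hp, hZ⟩ :=
      h M hM hM' ((prop_or_rightOrthogonal_of_quotients hquot).resolve_left hM')
    exact hZ (hquot p hp)

theorem le_of_rightOrthogonal_le (h : T'.1.rightOrthogonal ≤ T.1.rightOrthogonal) : T ≤ T' := by
  by_contra hle
  obtain ⟨M, hM, hM', hfree, -⟩ := exists_rightOrthogonal_of_not_le hle
  exact hM' (T'.1.prop_of_isZero (isZero_of_rightOrthogonal (h M hfree) hM))

theorem inf_sSup_le_of_forall_inf_eq {s : Set (TorsionClass A)} (h : ∀ x ∈ s, T ⊓ x = U) :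
    T ⊓ sSup s ≤ U := by
  by_contra hle
  obtain ⟨M, hM, hMU, -, hquot⟩ := exists_rightOrthogonal_of_not_le hle
  obtain ⟨hMT, hMs⟩ := inf_prop_iff.1 hM
  have hfree : (sSup s).1.rightOrthogonal M := rightOrthogonal_sSup_iff.2 fun x hx =>
    (prop_or_rightOrthogonal_of_quotients fun Z p _ hp =>
      (h x hx ▸ inf_le_right : U ≤ x) Z (hquot p hp)).resolve_left fun hMx =>
        hMU (h x hx ▸ inf_prop_iff.2 ⟨hMT, hMx⟩)
  exact hMU (U.1.prop_of_isZero (isZero_of_rightOrthogonal hfree hMs))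

theorem le_sup_sInf_of_forall_sup_eq [∀ X : A, IsArtinianObject X] {s : Set (TorsionClass A)}
    (h : ∀ x ∈ s, T ⊔ x = U) : U ≤ T ⊔ sInf s := by
  refine le_of_rightOrthogonal_le fun M hM => ?_
  induction M using subobject_induction with
  | h M ih =>
    have hsub : ∀ ⦃Y : A⦄ (i : Y ⟶ M) [Mono i], ¬ IsIso i → U.1.rightOrthogonal Y :=
      fun Y i _ hi => ih i hi (ObjectProperty.prop_of_mono _ i hM)
    obtain ⟨hMT, hMs⟩ := rightOrthogonal_sup_iff.1 hM
    by_cases hx : ∃ x ∈ s, x.1.rightOrthogonal M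
    · obtain ⟨x, hxs, hMx⟩ := hx
      exact h x hxs ▸ rightOrthogonal_sup_iff.2 ⟨hMT, hMx⟩
    · have hsM : (sInf s).1 M := fun x hxs =>
        (prop_or_rightOrthogonal_of_subobjects fun Y i _ hi =>
          rightOrthogonal_of_le (h x hxs ▸ le_sup_right : x ≤ U) (hsub i hi)).resolve_right
          fun hMx => hx ⟨x, hxs, hMx⟩
      exact fun X f _ => (isZero_of_rightOrthogonal hMs hsM).eq_of_tgt f 0

end Noetherian

variable (A) in
theorem isCompletelySemidistributive [∀ X : A, IsNoetherianObject X]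
    [∀ X : A, IsArtinianObject X] : IsCompletelySemidistributive (TorsionClass A) where
  sup_sInf T U s := by
    rintro ⟨x, hx⟩ h
    refine le_antisymm ?_ (le_sup_sInf_of_forall_sup_eq h)
    exact h x hx ▸ sup_le_sup_left (sInf_le hx) T
  inf_sSup T U s := by
    rintro ⟨x, hx⟩ h
    refine le_antisymm (inf_sSup_le_of_forall_inf_eq h) ?_
    exact h x hx ▸ inf_le_inf_left T (le_sSup hx)

end TorsionClass

end TorsionPairs

section KernelCokernel

variable {A : Type u} [Category.{v} A] [Abelian A]
variable (P : ObjectProperty A) {X Y Z : A}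

variable {P} in
theorem isClosedUnderKernels_of_prop_kernel [P.IsClosedUnderIsomorphisms]
    (h : ∀ ⦃X Y : A⦄ (f : X ⟶ Y), P X → P Y → P (kernel f)) : P.IsClosedUnderKernels where
  kernels_le _ := fun ⟨f, _, hk, hX, hY⟩ =>
    P.prop_of_iso ((kernelIsKernel f).conePointUniqueUpToIso hk) (h f hX hY)

variable {P} in
theorem isClosedUnderCokernels_of_prop_cokernel [P.IsClosedUnderIsomorphisms]
    (h : ∀ ⦃X Y : A⦄ (f : X ⟶ Y), P X → P Y → P (cokernel f)) : P.IsClosedUnderCokernels where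
  cokernels_le _ := fun ⟨f, _, hc, hX, hY⟩ =>
    P.prop_of_iso ((cokernelIsCokernel f).coconePointUniqueUpToIso hc) (h f hX hY)

instance isClosedUnderIsomorphisms_of_isClosedUnderKernels [P.IsClosedUnderKernels] :
    P.IsClosedUnderIsomorphisms where
  of_iso {X _} e hX :=
    P.prop_of_isLimit_kernelFork (f := (0 : X ⟶ X))
      ((KernelFork.IsLimit.ofId _ rfl).ofIsoLimit
        (Fork.ext e : _ ≅ KernelFork.ofι e.inv comp_zero)) hX hX

theorem prop_kernel_of_exact [P.IsClosedUnderQuotients] {S : ShortComplex A} (hS : S.Exact)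
    (h : P S.X₁) : P (kernel S.g) :=
  have := hS.epi_kernelLift
  P.prop_of_epi (kernel.lift S.g S.f S.zero) h

/-- Uniqueness of kernels at the left end of an exact sequence `0 ⟶ X₁ ⟶ X₂ ⟶ X₃`. -/
def kernelIsoOfExact {S : ShortComplex A} (hS : S.Exact) [Mono S.f] : kernel S.g ≅ S.X₁ :=
  (kernelIsKernel S.g).conePointUniqueUpToIso hS.fIsKernel

/-- Uniqueness of cokernels at the right end of an exact sequence `X₁ ⟶ X₂ ⟶ X₃ ⟶ 0`. -/
def cokernelIsoOfExact {S : ShortComplex A} (hS : S.Exact) [Epi S.g] : cokernel S.f ≅ S.X₃ :=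
  (cokernelIsCokernel S.f).coconePointUniqueUpToIso hS.gIsCokernel

variable (f : X ⟶ Y) (g : Y ⟶ Z)

open kernelCokernelCompSequence

theorem prop_kernel_of_epi_comp [P.IsClosedUnderQuotients] [Epi f] (h : P (kernel (f ≫ g))) :
    P (kernel g) := by
  have : Epi (kernel.map (f ≫ g) g f (𝟙 Z) (by simp)) :=
    (snakeInput f g).L₁'_exact.epi_f ((isZero_cokernel_of_epi f).eq_of_tgt _ _)
  exact P.prop_of_epi (kernel.map (f ≫ g) g f (𝟙 Z) _) h

theorem prop_kernel_of_mono_comp [P.IsClosedUnderExtensions] [P.IsClosedUnderIsomorphisms] [Mono f]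
    (h₁ : P (kernel (f ≫ g)))
    (h₂ : P (kernel (cokernel.map f (f ≫ g) (𝟙 X) g (by simp)))) : P (kernel g) := by
  let D := snakeInput f g
  have : Mono D.L₁'.f := D.L₀_exact.mono_g ((isZero_kernel_of_mono f).eq_of_src _ _)
  let p : kernel g ⟶ kernel D.L₃.f := kernel.lift D.L₃.f D.L₂'.f D.L₂'.zero
  have : Epi p := D.L₂'_exact.epi_kernelLift
  have e : kernel p ≅ kernel (f ≫ g) :=
    (kernelCompMono p (kernel.ι D.L₃.f)).symm ≪≫ kernelIsoOfEq (kernel.lift_ι _ _ _) ≪≫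
      kernelIsoOfExact D.L₁'_exact
  exact prop_of_epi_of_prop_kernel P p (P.prop_of_iso e.symm h₁) h₂

/-- The cokernel of `g` read off the end `cokernel f ⟶ cokernel (f ≫ g) ⟶ cokernel g ⟶ 0` of the
kernel-cokernel sequence of `f ≫ g`. -/
def cokernelCokernelMapIso :
    cokernel (cokernel.map f (f ≫ g) (𝟙 X) g (by simp)) ≅ cokernel g :=
  have : Epi (snakeInput f g).L₃.g :=
    inferInstanceAs (Epi (cokernel.map (f ≫ g) g f (𝟙 Z) (by simp)))
  cokernelIsoOfExact (snakeInput f g).L₃_exact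

/-- The kernel of `f` read off the start `0 ⟶ kernel f ⟶ kernel (f ≫ g) ⟶ kernel g` of the
kernel-cokernel sequence of `f ≫ g`. -/
def kernelKernelMapIso : kernel (kernel.map (f ≫ g) g f (𝟙 Z) (by simp)) ≅ kernel f :=
  have : Mono (snakeInput f g).L₀.f :=
    inferInstanceAs (Mono (kernel.map f (f ≫ g) (𝟙 X) g (by simp)))
  kernelIsoOfExact (snakeInput f g).L₀_exact

end KernelCokernel

section TorsionClosure

variable {A : Type u} [Category.{v} A] [Abelian A]

section

variable {P : ObjectProperty A} {T : TorsionClass A}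

theorem torsionClosure_le_iff : torsionClosure P ≤ T ↔ P ≤ T.1 :=
  ⟨fun h X hX => h X fun _ hU => hU X hX, fun h => sInf_le h⟩

theorem le_torsionClosure (P : ObjectProperty A) : P ≤ (torsionClosure P).1 :=
  torsionClosure_le_iff.1 le_rfl

theorem torsionClosure_mono : Monotone (torsionClosure (A := A)) := fun _ Q h =>
  torsionClosure_le_iff.2 (h.trans (le_torsionClosure Q))

variable {B : A}

theorem torsionClosure_singleton_le_iff : torsionClosure (.singleton B) ≤ T ↔ T.1 B := by
  rw [torsionClosure_le_iff, ObjectProperty.singleton_le_iff]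

theorem torsionClosure_singleton_prop_self (B : A) : (torsionClosure (.singleton B)).1 B :=
  torsionClosure_singleton_le_iff.1 le_rfl

end

namespace TorsionClass

variable (T : TorsionClass A) (C : ObjectProperty A)

/-- The torsion class of the objects all of whose morphisms to objects of `C` have their cokernel
in `C` and their kernel in `T`. -/
def kerCokerClass [C.IsClosedUnderIsomorphisms] : TorsionClass A where
  val X := ∀ ⦃M : A⦄, C M → ∀ f : X ⟶ M, C (cokernel f) ∧ T.1 (kernel f)
  property :=
    { containsZero := ⟨_, isZero_zero A, fun M hM f => by
        obtain rfl : f = 0 := (isZero_zero A).eq_of_src f 0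
        exact ⟨C.prop_of_iso cokernelZeroIsoTarget.symm hM,
          T.1.prop_of_isZero ((isZero_zero A).of_mono (kernel.ι _))⟩⟩
      quotients := ⟨fun p _ hX _ hM f =>
        ⟨C.prop_of_iso (cokernelEpiComp p f) (hX hM (p ≫ f)).1,
          prop_kernel_of_epi_comp T.1 p f (hX hM (p ≫ f)).2⟩⟩
      extensions := ⟨fun {S} hS h₁ h₃ M hM f => by
        have := hS.mono_f
        have := hS.epi_g
        obtain ⟨hC₁, hT₁⟩ := h₁ hM (S.f ≫ f)
        have e : cokernel S.f ≅ S.X₃ := cokernelIsoOfExact hS.exact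
        let f₃ := cokernel.map S.f (S.f ≫ f) (𝟙 _) f (by simp)
        obtain ⟨hC₃, hT₃⟩ := h₃ hC₁ (e.inv ≫ f₃)
        exact ⟨C.prop_of_iso (cokernelEpiComp e.inv f₃ ≪≫ cokernelCokernelMapIso S.f f) hC₃,
          prop_kernel_of_mono_comp T.1 S.f f hT₁ (prop_kernel_of_epi_comp T.1 e.inv f₃ hT₃)⟩⟩ }

variable {T C}

theorem le_kerCokerClass [C.IsClosedUnderKernels] [C.IsClosedUnderCokernels] (h : C ≤ T.1) :
    C ≤ (kerCokerClass T C).1 :=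
  fun _ hX _ hM f => ⟨C.prop_cokernel f hX hM, h _ (C.prop_kernel f hX hM)⟩

theorem inf_leftPerp_le_kerCokerClass [C.IsClosedUnderIsomorphisms] :
    T ⊓ leftPerp C ≤ kerCokerClass T C := by
  intro X hX M hM f
  obtain ⟨hXT, hXC⟩ := inf_prop_iff.1 hX
  obtain rfl : f = 0 := hXC f hM
  exact ⟨C.prop_of_iso cokernelZeroIsoTarget.symm hM, T.1.prop_of_iso kernelZeroIsoSource.symm hXT⟩

theorem le_kerCokerClass_of_le_sup [C.IsClosedUnderKernels] [C.IsClosedUnderCokernels]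
    (hC : C ≤ T.1) (h : T ≤ torsionClosure C ⊔ (T ⊓ leftPerp C)) : T ≤ kerCokerClass T C :=
  h.trans (sup_le (torsionClosure_le_iff.2 (le_kerCokerClass hC)) inf_leftPerp_le_kerCokerClass)

theorem torsionClosure_le_kerCokerClass [C.IsClosedUnderKernels] [C.IsClosedUnderCokernels] :
    torsionClosure C ≤ kerCokerClass (torsionClosure C) C :=
  le_kerCokerClass_of_le_sup (le_torsionClosure C) le_sup_left

end TorsionClass

section

variable {C : ObjectProperty A} [C.IsClosedUnderKernels] [C.IsClosedUnderCokernels] {X M : A}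

theorem prop_image_of_torsionClosure (hX : (torsionClosure C).1 X) (hM : C M) (f : X ⟶ M) :
    C (Abelian.image f) :=
  C.prop_kernel _ hM (TorsionClass.torsionClosure_le_kerCokerClass X hX hM f).1

theorem torsionClosure_prop_kernel (hX : (torsionClosure C).1 X) (hM : C M) (f : X ⟶ M) :
    (torsionClosure C).1 (kernel f) :=
  (TorsionClass.torsionClosure_le_kerCokerClass X hX hM f).2

end

end TorsionClosure

section ZeroOrIso

variable {A : Type u} [Category.{v} A]

/-- The full subcategory of the objects which are zero or isomorphic to `B`. If `B` is a brick, it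
is closed under kernels and cokernels, though usually not under extensions. -/
def zeroOrIso (B : A) : ObjectProperty A := fun X => IsZero X ∨ Nonempty (X ≅ B)

theorem zeroOrIso_self (B : A) : zeroOrIso B B := .inr ⟨Iso.refl B⟩

instance (B : A) : (zeroOrIso B).IsClosedUnderIsomorphisms where
  of_iso e := .imp (·.of_iso e.symm) fun ⟨e'⟩ => ⟨e.symm ≪≫ e'⟩

theorem zeroOrIso_le {P : ObjectProperty A} [P.IsClosedUnderIsomorphisms] [P.ContainsZero] {B : A}
    (hB : P B) : zeroOrIso B ≤ P := by
  rintro X (hX | ⟨⟨e⟩⟩)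
  exacts [P.prop_of_isZero hX, P.prop_of_iso e.symm hB]

end ZeroOrIso

section BricksAndSimples

variable {A : Type u} [Category.{v} A] [Abelian A]

section Bricks

/-- `B` is a brick: it is nonzero, and all its nonzero endomorphisms are invertible. -/
structure IsBrick (B : A) : Prop where
  not_isZero : ¬ IsZero B
  isIso_of_ne_zero : ∀ f : B ⟶ B, f ≠ 0 → IsIso f

theorem torsionClosure_zeroOrIso (B : A) :
    torsionClosure (zeroOrIso B) = torsionClosure (.singleton B) :=
  le_antisymm
    (torsionClosure_le_iff.2 (zeroOrIso_le (torsionClosure_singleton_prop_self B)))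
    (torsionClosure_mono (ObjectProperty.singleton_le_iff.2 (zeroOrIso_self B)))

namespace IsBrick

variable {B : A} (hB : IsBrick B)
include hB

theorem isIso_of_zeroOrIso {X Y : A} (hX : zeroOrIso B X) (hY : zeroOrIso B Y) {f : X ⟶ Y}
    (hf : f ≠ 0) : IsIso f := by
  obtain hX | ⟨⟨e⟩⟩ := hX
  · exact (hf (hX.eq_of_src f 0)).elim
  obtain hY | ⟨⟨e'⟩⟩ := hY
  · exact (hf (hY.eq_of_tgt f 0)).elim
  have hne : e.inv ≫ f ≫ e'.hom ≠ 0 := fun h => hf (by simpa using e.hom ≫= h =≫ e'.inv)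
  have := hB.isIso_of_ne_zero _ hne
  have : IsIso (f ≫ e'.hom) := IsIso.of_isIso_comp_left e.inv _
  exact IsIso.of_isIso_comp_right f e'.hom

theorem isClosedUnderKernels_zeroOrIso : (zeroOrIso B).IsClosedUnderKernels :=
  isClosedUnderKernels_of_prop_kernel fun X Y f hX hY => by
    obtain rfl | hf := eq_or_ne f 0
    · exact (zeroOrIso B).prop_of_iso kernelZeroIsoSource.symm hX
    · have := hB.isIso_of_zeroOrIso hX hY hf
      exact .inl (isZero_kernel_of_mono f)

theorem isClosedUnderCokernels_zeroOrIso : (zeroOrIso B).IsClosedUnderCokernels :=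
  isClosedUnderCokernels_of_prop_cokernel fun X Y f hX hY => by
    obtain rfl | hf := eq_or_ne f 0
    · exact (zeroOrIso B).prop_of_iso cokernelZeroIsoTarget.symm hY
    · have := hB.isIso_of_zeroOrIso hX hY hf
      exact .inl (isZero_cokernel_of_epi f)

end IsBrick

end Bricks

section Simples

/-- `B` is a simple object of the full subcategory `C`. -/
structure IsSimpleIn (C : ObjectProperty A) (B : A) : Prop where
  prop : C B
  not_isZero : ¬ IsZero B
  isIso_of_mono : ∀ ⦃Y : A⦄ (i : Y ⟶ B) [Mono i], C Y → i ≠ 0 → IsIso i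

theorem IsBrick.isSimpleIn_zeroOrIso {B : A} (hB : IsBrick B) : IsSimpleIn (zeroOrIso B) B where
  prop := zeroOrIso_self B
  not_isZero := hB.not_isZero
  isIso_of_mono _ _ _ hY hi := hB.isIso_of_zeroOrIso hY (zeroOrIso_self B) hi

variable {C : ObjectProperty A}

theorem exists_mono_isSimpleIn [∀ X : A, IsArtinianObject X] {X : A} (hX : C X)
    (hX₀ : ¬ IsZero X) : ∃ (B : A) (i : B ⟶ X), Mono i ∧ IsSimpleIn C B := by
  induction X using subobject_induction with
  | h X ih =>
    by_cases hs : IsSimpleIn C X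
    · exact ⟨X, 𝟙 X, inferInstance, hs⟩
    obtain ⟨Y, i, _, hY, hi, hiso⟩ :
        ∃ (Y : A) (i : Y ⟶ X), Mono i ∧ C Y ∧ i ≠ 0 ∧ ¬ IsIso i := by
      contrapose! hs
      exact ⟨hX, hX₀, hs⟩
    obtain ⟨B, j, _, hB⟩ := ih i hiso hY fun h => hi (h.eq_of_src i 0)
    exact ⟨B, j ≫ i, inferInstance, hB⟩

theorem le_of_isSimpleIn_le [∀ X : A, IsArtinianObject X] [∀ X : A, IsNoetherianObject X]
    [C.IsClosedUnderCokernels] {P : ObjectProperty A} [P.IsClosedUnderExtensions]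
    [P.IsClosedUnderIsomorphisms] [P.ContainsZero] (hP : IsSimpleIn C ≤ P) : C ≤ P := by
  intro X hX
  induction X using quotient_induction with
  | h X ih =>
    by_cases hX₀ : IsZero X
    · exact P.prop_of_isZero hX₀
    obtain ⟨B, i, _, hB⟩ := exists_mono_isSimpleIn hX hX₀
    have hi : i ≠ 0 := fun h => hB.not_isZero (IsZero.of_mono_eq_zero i h)
    exact prop_of_mono_of_prop_cokernel P i (hP B hB)
      (ih (cokernel.π i) (not_isIso_cokernel_π hi) (C.prop_cokernel i hB.prop hX))

namespace IsSimpleIn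

variable [C.IsClosedUnderKernels] [C.IsClosedUnderCokernels] {B B' : A}

theorem epi_of_ne_zero (hB : IsSimpleIn C B) {X : A} (hX : (torsionClosure C).1 X) {f : X ⟶ B}
    (hf : f ≠ 0) : Epi f :=
  have := hB.isIso_of_mono (Abelian.image.ι f) (prop_image_of_torsionClosure hX hB.prop f)
    (image_ι_ne_zero hf)
  epi_of_isIso_image_ι f

theorem isIso_of_ne_zero (hB : IsSimpleIn C B) (hB' : IsSimpleIn C B') {f : B ⟶ B'}
    (hf : f ≠ 0) : IsIso f := by
  have : Epi f := hB'.epi_of_ne_zero (le_torsionClosure C B hB.prop) hf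
  have : Mono f := Preadditive.mono_of_kernel_zero <| by_contra fun h =>
    not_isIso_kernel_ι hf (hB.isIso_of_mono _ (C.prop_kernel f hB.prop hB'.prop) h)
  exact isIso_of_mono_of_epi f

theorem isBrick (hB : IsSimpleIn C B) : IsBrick B :=
  ⟨hB.not_isZero, fun _ => hB.isIso_of_ne_zero hB⟩

end IsSimpleIn

variable [∀ X : A, IsArtinianObject X] [∀ X : A, IsNoetherianObject X]
  [C.IsClosedUnderKernels] [C.IsClosedUnderCokernels]

variable (C) in
theorem isCanonicalJoinRep_torsionClosure :
    IsCanonicalJoinRep (torsionClosure C)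
      ((fun B => torsionClosure (.singleton B)) '' {B | IsSimpleIn C B}) where
  eq_sSup := by
    refine le_antisymm (torsionClosure_le_iff.2 (le_of_isSimpleIn_le fun B hB => ?_)) (sSup_le ?_)
    · exact torsionClosure_singleton_le_iff.1 (le_sSup ⟨B, hB, rfl⟩)
    · rintro _ ⟨B, hB, rfl⟩
      exact torsionClosure_singleton_le_iff.2 (le_torsionClosure C B hB.prop)
  refines := by
    rintro s hs _ ⟨B, hB, rfl⟩
    obtain ⟨T, hT, hTB⟩ : ∃ T ∈ s, ¬ T.1.rightOrthogonal B := by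
      have hsB : (sSup s).1 B := hs ▸ le_torsionClosure C B hB.prop
      have := mt (isZero_of_rightOrthogonal · hsB) hB.not_isZero
      simpa only [TorsionClass.rightOrthogonal_sSup_iff, not_forall, exists_prop] using this
    obtain ⟨Y, f, hY, hf⟩ := exists_ne_zero_of_not_rightOrthogonal hTB
    have : Epi f := hB.epi_of_ne_zero ((hs ▸ le_sSup hT : T ≤ torsionClosure C) Y hY) hf
    exact ⟨T, hT, torsionClosure_singleton_le_iff.2 (T.1.prop_of_epi f hY)⟩
  antichain := by
    rintro _ ⟨B, hB, rfl⟩ _ ⟨B', hB', rfl⟩ h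
    refine le_antisymm h (torsionClosure_singleton_le_iff.2 ?_)
    obtain ⟨f, hf⟩ : ∃ f : B' ⟶ B, f ≠ 0 := by
      by_contra! h₀
      have hperp : torsionClosure (.singleton B') ≤ TorsionClass.leftPerp (.singleton B) :=
        torsionClosure_singleton_le_iff.2 (TorsionClass.leftPerp_singleton_prop_iff.2 h₀)
      exact hB.not_isZero (isZero_of_leftOrthogonal
        ((h.trans hperp) B (torsionClosure_singleton_prop_self B)) (by simp))
    have := hB'.isIso_of_ne_zero hB hf
    exact ObjectProperty.prop_of_epi _ (inv f) (torsionClosure_singleton_prop_self B)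

end Simples

namespace IsBrick

open TorsionClass

variable {B : A} (hB : IsBrick B)
include hB

theorem epi_of_ne_zero {X : A} (hX : (torsionClosure (.singleton B)).1 X) {f : X ⟶ B}
    (hf : f ≠ 0) : Epi f :=
  have := hB.isClosedUnderKernels_zeroOrIso
  have := hB.isClosedUnderCokernels_zeroOrIso
  hB.isSimpleIn_zeroOrIso.epi_of_ne_zero (torsionClosure_zeroOrIso B ▸ hX) hf

theorem not_leftPerp_singleton_prop_self : ¬ (leftPerp (.singleton B)).1 B := fun h =>
  hB.not_isZero (isZero_of_leftOrthogonal h (by simp))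

theorem leftPerp_singleton_prop_of_epi {Z : A} (p : B ⟶ Z) [Epi p] (hp : ¬ IsIso p) :
    (leftPerp (.singleton B)).1 Z := by
  refine leftPerp_singleton_prop_iff.2 fun f => by_contra fun hf => hp ?_
  have := hB.isIso_of_ne_zero (p ≫ f) fun h => hf (by rw [← cancel_epi p, h, comp_zero])
  have : Mono p := mono_of_mono p f
  exact isIso_of_mono_of_epi p

theorem lowerStar_torsionClosure :
    lowerStar (torsionClosure (.singleton B)) =
      torsionClosure (.singleton B) ⊓ leftPerp (.singleton B) := by
  have hlt : torsionClosure (.singleton B) ⊓ leftPerp (.singleton B) <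
      torsionClosure (.singleton B) :=
    inf_le_left.lt_of_not_ge fun h => hB.not_leftPerp_singleton_prop_self
      (inf_prop_iff.1 (h B (torsionClosure_singleton_prop_self B))).2
  refine le_antisymm (sSup_le fun T (hT : T < _) => le_inf hT.le fun X hX => ?_) (le_sSup hlt)
  refine leftPerp_singleton_prop_iff.2 fun f => by_contra fun hf => ?_
  have : Epi f := hB.epi_of_ne_zero (hT.le X hX) hf
  exact hT.not_ge (torsionClosure_singleton_le_iff.2 (T.1.prop_of_epi f hX))

theorem le_leftPerp_singleton {T : TorsionClass A}
    (h : lowerStar (torsionClosure (.singleton B)) ≤ T) (hBT : ¬ T.1 B) :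
    T ≤ leftPerp (.singleton B) := by
  rw [hB.lowerStar_torsionClosure] at h
  refine le_leftPerp_singleton_iff.2 ((prop_or_rightOrthogonal_of_quotients
    fun Z p _ hp => h Z (inf_prop_iff.2 ⟨?_, ?_⟩)).resolve_left hBT)
  · exact ObjectProperty.prop_of_epi _ p (torsionClosure_singleton_prop_self B)
  · exact hB.leftPerp_singleton_prop_of_epi p hp

theorem kappa_torsionClosure :
    kappa (torsionClosure (.singleton B)) = leftPerp (.singleton B) := by
  refine le_antisymm (sSup_le fun T hT => ?_) (le_sSup hB.lowerStar_torsionClosure.symm)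
  have hT : torsionClosure (.singleton B) ⊓ T = lowerStar (torsionClosure (.singleton B)) := hT
  refine hB.le_leftPerp_singleton (hT ▸ inf_le_right) fun hBT => ?_
  have hBstar := inf_prop_iff.2 ⟨torsionClosure_singleton_prop_self B, hBT⟩
  rw [hT, hB.lowerStar_torsionClosure] at hBstar
  exact hB.not_leftPerp_singleton_prop_self (inf_prop_iff.1 hBstar).2

end IsBrick

variable (C : ObjectProperty A) [∀ X : A, IsArtinianObject X] [∀ X : A, IsNoetherianObject X]
  [C.IsClosedUnderKernels] [C.IsClosedUnderCokernels]

theorem sInf_kappa_image_isSimpleIn :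
    sInf (kappa '' ((fun B => torsionClosure (.singleton B)) '' {B | IsSimpleIn C B})) =
      TorsionClass.leftPerp C := by
  refine le_antisymm (TorsionClass.le_leftPerp_iff.2 (le_of_isSimpleIn_le fun B hB => ?_))
    (le_sInf ?_)
  · rw [← TorsionClass.le_leftPerp_singleton_iff, ← hB.isBrick.kappa_torsionClosure]
    exact sInf_le ⟨_, ⟨B, hB, rfl⟩, rfl⟩
  · rintro _ ⟨_, ⟨B, hB, rfl⟩, rfl⟩
    rw [hB.isBrick.kappa_torsionClosure]
    exact TorsionClass.leftPerp_antitone (ObjectProperty.singleton_le_iff.2 hB.prop)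

end BricksAndSimples

section Wide

variable {A : Type u} [Category.{v} A] [Abelian A]

section WideCore

variable (T : TorsionClass A)

/-- The objects of `T` such that every morphism to them from an object of `T` has its kernel
in `T`. This is the wide subcategory attached to `T`, see `isWideSubcategory_wideCore`. -/
def wideCore : ObjectProperty A := fun X =>
  T.1 X ∧ ∀ ⦃Y : A⦄, T.1 Y → ∀ g : Y ⟶ X, T.1 (kernel g)

variable {T}

theorem wideCore.of_mono {X' X : A} (hX : wideCore T X) (m : X' ⟶ X) [Mono m] (hX' : T.1 X') :
    wideCore T X' :=
  ⟨hX', fun _ hY g => T.1.prop_of_iso (kernelCompMono g m) (hX.2 hY (g ≫ m))⟩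

theorem wideCore.of_epi {X Z : A} (hX : wideCore T X) (c : X ⟶ Z) [Epi c]
    (hc : T.1 (kernel c)) : wideCore T Z := by
  refine ⟨T.1.prop_of_epi c hX.1, fun Y hY g => ?_⟩
  have sq := IsPullback.of_hasPullback g c
  have := isIso_kernel_map_of_isPullback sq
  have := isIso_kernel_map_of_isPullback sq.flip
  have hE : T.1 (pullback g c) := prop_of_epi_of_prop_kernel T.1 (pullback.fst g c)
    (T.1.prop_of_iso (asIso (kernel.map _ _ _ _ sq.w)).symm hc) hY
  exact T.1.prop_of_iso (asIso (kernel.map _ _ _ _ sq.flip.w)) (hX.2 hE (pullback.snd g c))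

variable (T)

instance : (wideCore T).IsClosedUnderIsomorphisms where
  of_iso e hX := hX.of_mono e.inv (T.1.prop_of_iso e hX.1)

instance : (wideCore T).ContainsZero where
  exists_zero := ⟨_, isZero_zero A, T.1.prop_of_isZero (isZero_zero A), fun Y hY g => by
    obtain rfl : g = 0 := (isZero_zero A).eq_of_tgt g 0
    exact T.1.prop_of_iso kernelZeroIsoSource.symm hY⟩

instance : (wideCore T).IsClosedUnderExtensions where
  prop_X₂_of_shortExact {S} hS h₁ h₃ := by
    refine ⟨T.1.prop_X₂_of_shortExact hS h₁.1 h₃.1, fun Y hY g => ?_⟩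
    have := hS.mono_f
    let e : kernel S.g ≅ S.X₁ := kernelIsoOfExact hS.exact
    let l : kernel (g ≫ S.g) ⟶ kernel S.g := kernel.map _ _ g (𝟙 _) (by simp)
    exact T.1.prop_of_iso (kernelCompMono l e.hom ≪≫ kernelKernelMapIso g S.g)
      (h₁.2 (h₃.2 hY (g ≫ S.g)) (l ≫ e.hom))

theorem isWideSubcategory_wideCore : IsWideSubcategory (wideCore T) where
  isos := inferInstance
  containsZero := inferInstance
  extensions := inferInstance
  kernels := isClosedUnderKernels_of_prop_kernel fun _ _ f hX hY =>
    hX.of_mono (kernel.ι f) (hY.2 hX.1 f)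
  cokernels := isClosedUnderCokernels_of_prop_cokernel fun _ _ f hX hY =>
    hY.of_epi (cokernel.π f) (prop_kernel_of_exact T.1 (ShortComplex.exact_cokernel f) hX.1)

theorem torsionClosure_wideCore_le : torsionClosure (wideCore T) ≤ T :=
  torsionClosure_le_iff.2 fun _ hX => hX.1

end WideCore

section JoinIrreducible

theorem exists_isBrick_of_isCompletelyJoinIrreducible [∀ X : A, IsArtinianObject X]
    [∀ X : A, IsNoetherianObject X] {j : TorsionClass A} (hj : IsCompletelyJoinIrreducible j) :
    ∃ B, IsBrick B ∧ j = torsionClosure (.singleton B) := by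
  obtain ⟨B, hBj, hB, hfree, hquot⟩ :=
    TorsionClass.exists_rightOrthogonal_of_not_le hj.lowerStar_lt.not_ge
  refine ⟨B, ⟨mt (lowerStar j).1.prop_of_isZero hB, fun f hf => ?_⟩, ?_⟩
  · have : IsIso (Abelian.factorThruImage f) := by_contra fun h =>
      factorThruImage_ne_zero hf <| IsZero.eq_of_tgt (isZero_of_rightOrthogonal
        (ObjectProperty.prop_of_mono _ (Abelian.image.ι f) hfree) (hquot _ h)) _ _
    have := mono_of_isIso_factorThruImage f
    exact isIso_of_mono_endomorphism f
  · have hle : torsionClosure (.singleton B) ≤ j := torsionClosure_singleton_le_iff.2 hBj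
    exact (hle.eq_of_not_lt fun hlt => hB (torsionClosure_singleton_le_iff.1 (le_sSup hlt))).symm

theorem IsBrick.wideCore_of_sup_eq {B : A} (hB : IsBrick B) {T T' : TorsionClass A}
    (hT : torsionClosure (.singleton B) ⊔ T' = T)
    (hmin : ¬ torsionClosure (.singleton B) ≤
      lowerStar (torsionClosure (.singleton B)) ⊔ T') : wideCore T B := by
  have := hB.isClosedUnderKernels_zeroOrIso
  have := hB.isClosedUnderCokernels_zeroOrIso
  have hBT : T.1 B := torsionClosure_singleton_le_iff.1 (hT ▸ le_sup_left)
  have hperp : T' ≤ TorsionClass.leftPerp (zeroOrIso B) := by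
    have h := hB.le_leftPerp_singleton le_sup_left (mt torsionClosure_singleton_le_iff.2 hmin)
    exact TorsionClass.le_leftPerp_iff.2
      (zeroOrIso_le (TorsionClass.le_leftPerp_singleton_iff.1 (le_sup_right.trans h)))
  have hle : T ≤ TorsionClass.kerCokerClass T (zeroOrIso B) := by
    refine TorsionClass.le_kerCokerClass_of_le_sup (zeroOrIso_le hBT) ?_
    rw [torsionClosure_zeroOrIso]
    exact hT.ge.trans (sup_le_sup_left (le_inf (hT ▸ le_sup_right) hperp) _)
  exact ⟨hBT, fun Y hY g => (hle Y hY (zeroOrIso_self B) g).2⟩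

theorem torsionClosure_wideCore_of_isCanonicalJoinRep [∀ X : A, IsArtinianObject X]
    [∀ X : A, IsNoetherianObject X] {T : TorsionClass A} {S : Set (TorsionClass A)}
    (hS : IsCanonicalJoinRep T S) : torsionClosure (wideCore T) = T := by
  refine le_antisymm (torsionClosure_wideCore_le T) (hS.eq_sSup.trans_le (sSup_le fun j hj => ?_))
  obtain ⟨B, hB, rfl⟩ :=
    exists_isBrick_of_isCompletelyJoinIrreducible (hS.isCompletelyJoinIrreducible hj)
  exact torsionClosure_singleton_le_iff.2 (le_torsionClosure _ B
    (hB.wideCore_of_sup_eq (hS.sup_sSup_diff_singleton hj) (hS.not_le_lowerStar_sup hj)))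

end JoinIrreducible

section WideSubcategory

theorem prop_of_torsionClosure_of_rightOrthogonal [∀ X : A, IsArtinianObject X]
    {C : ObjectProperty A} [C.ContainsZero] [C.IsClosedUnderKernels] [C.IsClosedUnderCokernels]
    [C.IsClosedUnderExtensions] {X : A} (hX : (torsionClosure C).1 X)
    (hfree : C.leftOrthogonal.rightOrthogonal X) : C X := by
  induction X using subobject_induction with
  | h X ih =>
    by_cases hX₀ : IsZero X
    · exact C.prop_of_isZero hX₀
    obtain ⟨M, f, hM, hf⟩ :=
      exists_ne_zero_of_not_leftOrthogonal (mt (isZero_of_rightOrthogonal hfree) hX₀)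
    have hI : C (Abelian.image f) := prop_image_of_torsionClosure hX hM f
    let p : X ⟶ Abelian.image f := Abelian.factorThruImage f
    refine prop_of_epi_of_prop_kernel C p ?_ hI
    exact ih (kernel.ι p) (not_isIso_kernel_ι (factorThruImage_ne_zero hf))
      (torsionClosure_prop_kernel hX hI p) (ObjectProperty.prop_of_mono _ (kernel.ι p) hfree)

namespace WideSubcategory

section

variable (W : WideSubcategory A)

instance : W.1.ContainsZero := W.2.containsZero
instance : W.1.IsClosedUnderExtensions := W.2.extensions
instance : W.1.IsClosedUnderKernels := W.2.kernels
instance : W.1.IsClosedUnderCokernels := W.2.cokernels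

end

variable [∀ X : A, IsArtinianObject X] [∀ X : A, IsNoetherianObject X]

/-- The torsion closure of a wide subcategory, as an element of the kappa order. -/
def toKappaPoset (W : WideSubcategory A) : KappaPoset (TorsionClass A) :=
  ⟨torsionClosure W.1, _, isCanonicalJoinRep_torsionClosure W.1⟩

theorem extKappa_toKappaPoset (W : WideSubcategory A) :
    (toKappaPoset W).extKappa = TorsionClass.leftPerp W.1 := by
  rw [KappaPoset.extKappa, (toKappaPoset W).isCanonicalJoinRep_CJR.unique
    (isCanonicalJoinRep_torsionClosure W.1), sInf_kappa_image_isSimpleIn]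

theorem toKappaPoset_le_toKappaPoset_iff {W W' : WideSubcategory A} :
    toKappaPoset W ≤ toKappaPoset W' ↔ W ≤ W' := by
  have hle : toKappaPoset W ≤ toKappaPoset W' ↔ torsionClosure W.1 ≤ torsionClosure W'.1 ∧
      TorsionClass.leftPerp W'.1 ≤ TorsionClass.leftPerp W.1 := by
    rw [← extKappa_toKappaPoset, ← extKappa_toKappaPoset]
    exact Iff.rfl
  rw [hle]
  refine ⟨fun ⟨hT, hperp⟩ X hX => ?_, fun h =>
    ⟨torsionClosure_mono h, TorsionClass.leftPerp_antitone h⟩⟩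
  exact prop_of_torsionClosure_of_rightOrthogonal (hT X (le_torsionClosure W.1 X hX))
    (TorsionClass.le_leftPerp_iff.1 hperp X hX)

theorem toKappaPoset_surjective : Function.Surjective (toKappaPoset (A := A)) := fun x =>
  ⟨⟨wideCore x.val, isWideSubcategory_wideCore x.val⟩, KappaPoset.ext
    (torsionClosure_wideCore_of_isCanonicalJoinRep x.isCanonicalJoinRep_CJR)⟩

variable (A) in
/-- The order isomorphism from wide subcategories to the kappa order on torsion classes. -/
def orderIsoKappaPoset : WideSubcategory A ≃o KappaPoset (TorsionClass A) :=
  RelIso.ofSurjective (OrderEmbedding.ofMapLEIff toKappaPoset fun _ _ =>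
    toKappaPoset_le_toKappaPoset_iff) toKappaPoset_surjective

end WideSubcategory

end WideSubcategory

end Wide

end KappaOrder

end

theorem theorem4 {A : Type u} [Category.{v} A] [Abelian A] [KappaOrder.IsLengthCategory A] :
    KappaOrder.IsCompletelySemidistributive (KappaOrder.TorsionClass A) ∧
    ∃ e : KappaOrder.WideSubcategory A ≃o KappaOrder.KappaPoset (KappaOrder.TorsionClass A),
      ∀ W : KappaOrder.WideSubcategory A, (e W).val = KappaOrder.torsionClosure W.1 :=
  ⟨KappaOrder.TorsionClass.isCompletelySemidistributive A,
    KappaOrder.WideSubcategory.orderIsoKappaPoset A, fun _ => rfl⟩
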